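/- Let $F$ be a field of characteristic zero, $G$ a group, and $H\trianglelefteq N\trianglelefteq G$ subgroups such that $(G,H)$ is a Hecke pair, i.e. for every $x\in G$ the set $(H\cap x^{-1}Hx)\backslash H$ of right cosets is finite. On the $F$-vector space with basis $\{\delta_{u}: u\in H\backslash G\}$ let $\sigma_x$ ($x\in G$) be the linear operator $$\sigma_x(\delta_{Ht})=\frac1{|S_x|}\sum_{h\in S_x}\delta_{Hxht}\qquad(t\in G),$$ where $S_x\subseteq H$ is any family of representatives of $(H\cap x^{-1}Hx)\backslash H$, and let the Hecke algebra $\mathcal H(G,H)$ be the algebra of operators generated by $\{\sigma_x:x\in G\}$. A twisted partial action of a group $\Gamma$ on a unital $F$-algebra $A$ consists of two-sided ideals $D_t$ of $A$, algebra isomorphisms $\theta_t:D_{t^{-1}}\to D_t$ ($t\in\Gamma$) and invertible multipliers $w_{r,s}$ of $D_r\cap D_{rs}$ ($r,s\in\Gamma$) such that, for all $r,s,t\in\Gamma$: (i) $D_1=A$ and $\theta_1=\mathrm{id}$; (ii) $\theta_r(D_{r^{-1}}\cap D_s)=D_r\cap D_{rs}$; (iii) $\theta_r(\theta_s(a))=w_{r,s}\theta_{rs}(a)w_{r,s}^{-1}$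 for $a\in D_{s^{-1}}\cap D_{s^{-1}r^{-1}}$; (iv) $w_{1,t}=w_{t,1}=1$; (v) $\theta_r(aw_{s,t})w_{r,st}=\theta_r(a)w_{r,s}w_{rs,t}$ for $a\in D_{r^{-1}}\cap D_s\cap D_{st}$ (all terms being assumed defined). Its crossed product $A\rtimes\Gamma$ is $\bigoplus_{t\in\Gamma}D_t$ (the copy of $a\in D_t$ in the $t$-th summand being written $a\delta_t$) with the bilinear multiplication $(a\delta_r)(b\delta_s)=\theta_r(\theta_r^{-1}(a)b)\,w_{r,s}\,\delta_{rs}$. Let $\xi:G/N\to G$ be any section of the quotient map with $\xi(1)=1$. Then: (a) There is an injective homomorphism of unital $F$-algebras $F[N/H]\to\mathcal H(G,H)$ that sends the class of $n\in N$ to $\sigma_n$; we use it to identify $F[N/H]$ with a subalgebra of $\mathcal H(G,H)$. (b) There is a twisted partial action of $G/N$ on $F[N/H]$ such that: for every $x\in G$, the element $\sigma_x\sigma_{x^{-1}}$ is a central idempotent of $F[N/H]$, and the ideal $D_{xN}$ is the ideal of $F[N/H]$ generated by it; $\theta_t(a)=\sigma_{\xi(t)}\,a\,\sigma_{\xi(t)^{-1}}$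 for $t\in G/N$ and $a\in D_{t^{-1}}$; and, for $r,s\in G/N$, $w_{r,s}$ is the multiplier given by multiplication by the element $\sigma_{\xi(r)\xi(s)\xi(rs)^{-1}}$ of $F[N/H]$. (c) The crossed product $F[N/H]\rtimes G/N$ relative to this twisted partial action is isomorphic to $\mathcal H(G,H)$ as an $F$-algebra. -/

import Mathlib

noncomputable section

namespace HeckeCrossed

section Hecke

variable {G : Type*} [Group G]

/-- The conjugate subgroup `H^x = x⁻¹ H x`. -/
def conjSubgroup (H : Subgroup G) (x : G) : Subgroup G :=
  H.map (MulAut.conj x⁻¹).toMonoidHom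

/-- The space of right cosets `(H ∩ H^x) k`, `k ∈ H`. -/
abbrev InnerCosets (H : Subgroup G) (x : G) : Type _ :=
  Quotient (QuotientGroup.rightRel ((H ⊓ conjSubgroup H x).subgroupOf H))

/-- `(G, H)` is a Hecke pair: for each `x ∈ G`, there are only finitely many right cosets of
`H ∩ x⁻¹Hx` in `H`. -/
def IsHeckePair (H : Subgroup G) : Prop :=
  ∀ x : G, Finite (InnerCosets H x)

/-- The space of right cosets `Hg` in `G`. -/
abbrev RightCosets (H : Subgroup G) : Type _ :=
  Quotient (QuotientGroup.rightRel H)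

/-- The right coset `Hg`. -/
def rightCoset (H : Subgroup G) (g : G) : RightCosets H :=
  Quotient.mk (QuotientGroup.rightRel H) g

theorem rightCoset_eq_iff (H : Subgroup G) (a b : G) :
    rightCoset H a = rightCoset H b ↔ b * a⁻¹ ∈ H := by
  unfold rightCoset
  rw [Quotient.eq, QuotientGroup.rightRel_apply]

variable (F : Type*) [Field F]

/-- The operator `σ_x` on the `F`-vector space with basis `δ_u` (`u` a right coset of `H` in `G`):
`σ_x(δ_{Ht}) = (1/|S|) ∑_{h ∈ S} δ_{Hxht}`, where `S` is a family of representatives for the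
right cosets of `H ∩ x⁻¹Hx` in `H`. See `sigma_single` for the independence of the choices. -/
def sigma (H : Subgroup G) (x : G) : Module.End F (RightCosets H →₀ F) :=
  Finsupp.linearCombination F fun u : RightCosets H =>
    (Nat.card (InnerCosets H x) : F)⁻¹ •
      ∑ᶠ k : InnerCosets H x, Finsupp.single (rightCoset H (x * (k.out : G) * u.out)) (1 : F)

/-- The formula for `σ_x(δ_{Ht})`, for an arbitrary `t` in the coset and an arbitrary finite family
`S` of representatives of the right cosets of `H ∩ x⁻¹Hx` in `H`. -/
theorem sigma_single (H : Subgroup G) (x t : G) (S : Finset H)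
    (hS : ∀ k : InnerCosets H x, ∃! h : H, h ∈ S ∧
      Quotient.mk (QuotientGroup.rightRel ((H ⊓ conjSubgroup H x).subgroupOf H)) h = k) :
    sigma F H x (Finsupp.single (rightCoset H t) 1) =
      (S.card : F)⁻¹ • ∑ h ∈ S, Finsupp.single (rightCoset H (x * (h : G) * t)) (1 : F) := by
  classical
  set K := (H ⊓ conjSubgroup H x).subgroupOf H with hK
  let q : H → InnerCosets H x := Quotient.mk (QuotientGroup.rightRel K)
  have hq : ∀ a b : H, q a = q b ↔ b * a⁻¹ ∈ K := fun a b => by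
    rw [← QuotientGroup.rightRel_apply]
    exact Quotient.eq
  have hqout : ∀ k, q k.out = k := fun k => Quotient.out_eq k
  have hbij : Function.Bijective (fun h : S => q h) := by
    constructor
    · intro a b hab
      exact Subtype.ext ((hS (q b)).unique ⟨a.2, hab⟩ ⟨b.2, rfl⟩)
    · intro k
      obtain ⟨h, ⟨h₁, h₂⟩, -⟩ := hS k
      exact ⟨⟨h, h₁⟩, h₂⟩
  let e := Equiv.ofBijective _ hbij
  have hfin : Finite (InnerCosets H x) := Finite.of_equiv _ e
  let _ : Fintype (InnerCosets H x) := Fintype.ofFinite _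
  have hcard : Nat.card (InnerCosets H x) = S.card := by
    rw [← Nat.card_congr e]
    simp
  -- the summand depends only on the class of `h`
  have hwd : ∀ a b : H, q a = q b →
      rightCoset H (x * (a : G) * t) = rightCoset H (x * (b : G) * t) := by
    intro a b hab
    rw [hq, hK, Subgroup.mem_subgroupOf] at hab
    obtain ⟨-, y, hy, hyx⟩ := hab
    rw [rightCoset_eq_iff]
    have : y = x * ((b * a⁻¹ : H) : G) * x⁻¹ := by
      rw [← hyx]
      simp [mul_assoc]
    rw [this] at hy
    convert hy using 1
    simp [mul_assoc]
  obtain ⟨l, hl⟩ : ∃ l : H, (rightCoset H t).out = (l : G) * t := by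
    have h : rightCoset H t = rightCoset H (rightCoset H t).out := (Quotient.out_eq _).symm
    rw [rightCoset_eq_iff] at h
    exact ⟨⟨_, h⟩, by simp⟩
  have hmul : Function.Bijective (fun k : InnerCosets H x => q (k.out * l)) := by
    refine (Finite.injective_iff_bijective).1 fun a b hab => ?_
    simp only [hq] at hab
    rw [← hqout a, ← hqout b, hq]
    simpa [mul_assoc] using hab
  have hsum : ∑ k : InnerCosets H x,
      Finsupp.single (rightCoset H (x * ((k.out : H) : G) * (rightCoset H t).out)) (1 : F) =
      ∑ k : InnerCosets H x, Finsupp.single (rightCoset H (x * ((k.out : H) : G) * t)) (1 : F) := by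
    refine Fintype.sum_bijective _ hmul _ _ fun k => ?_
    congr 1
    rw [hl, hwd (Quotient.out (q (k.out * l))) (k.out * l) (hqout _)]
    simp [mul_assoc]
  have hsum' : ∑ k : InnerCosets H x,
      Finsupp.single (rightCoset H (x * ((k.out : H) : G) * t)) (1 : F) =
      ∑ h ∈ S, Finsupp.single (rightCoset H (x * (h : G) * t)) (1 : F) := by
    rw [← Finset.sum_coe_sort S]
    refine (Fintype.sum_bijective _ hbij _ _ fun h => ?_).symm
    congr 1
    exact (hwd _ _ (hqout _)).symm
  rw [sigma, Finsupp.linearCombination_single, one_smul, hcard, finsum_eq_sum_of_fintype, hsum,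
    hsum']

/-- The Hecke algebra of `(G, H)`: the algebra of operators generated by the `σ_x`, `x ∈ G`.
(Since `σ_1 = 1` it does not matter whether the unit is added.) -/
def heckeAlgebra (H : Subgroup G) : Subalgebra F (Module.End F (RightCosets H →₀ F)) :=
  Algebra.adjoin F (Set.range (sigma F H))

/-- `σ_x` as an element of the Hecke algebra. -/
def heckeSigma (H : Subgroup G) (x : G) : heckeAlgebra F H :=
  ⟨sigma F H x, Algebra.subset_adjoin ⟨x, rfl⟩⟩

end Hecke

section Multiplier

/-- A multiplier of a (not necessarily unital) `F`-algebra `B`: a pair of linear maps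
`L(b) = w b` and `R(b) = b w` satisfying the associativity rules below. -/
@[ext]
structure Multiplier (F B : Type*) [Field F] [NonUnitalRing B] [Module F B] where
  /-- left multiplication `b ↦ w b` -/
  L : B →ₗ[F] B
  /-- right multiplication `b ↦ b w` -/
  R : B →ₗ[F] B
  L_mul : ∀ a b, L (a * b) = L a * b
  R_mul : ∀ a b, R (a * b) = a * R b
  R_mul_eq : ∀ a b, R a * b = a * L b

/-- The algebra structure of multipliers: `(ww')b = w(w'b)` and `b(ww') = (bw)w'`. -/
instance (F B : Type*) [Field F] [NonUnitalRing B] [Module F B] : Monoid (Multiplier F B) where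
  one := ⟨LinearMap.id, LinearMap.id, fun _ _ => rfl, fun _ _ => rfl, fun _ _ => rfl⟩
  mul w w' := ⟨w.L ∘ₗ w'.L, w'.R ∘ₗ w.R,
    fun a b => by simp [w.L_mul, w'.L_mul],
    fun a b => by simp [w.R_mul, w'.R_mul],
    fun a b => by simp [w.R_mul_eq, w'.R_mul_eq]⟩
  mul_assoc _ _ _ := rfl
  one_mul _ := rfl
  mul_one _ := rfl

end Multiplier

/-- A twisted partial action of a group `Γ` on a unital `F`-algebra `A`. Where a postulate applies
`θ` or a multiplier to an element, it includes that this element lies in the ideal in question. -/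
structure TwistedPartialAction (F Γ A : Type*) [Field F] [Group Γ] [Ring A] [Algebra F A] where
  /-- the ideals -/
  D : Γ → Ideal A
  two_sided : ∀ t, (D t).IsTwoSided
  /-- the isomorphisms `D_{t⁻¹} → D_t` -/
  θ : ∀ t, D t⁻¹ ≃ₗ[F] D t
  θ_mul : ∀ t (a b : D t⁻¹), θ t (a * b) = θ t a * θ t b
  /-- the cocycle of invertible multipliers -/
  w : ∀ r s, (Multiplier F ↥(D r ⊓ D (r * s)))ˣ
  D_one : D 1 = ⊤
  θ_one : ∀ a : D 1⁻¹, (θ 1 a : A) = a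
  θ_image : ∀ r s,
    (fun a : D r⁻¹ => (θ r a : A)) '' {a | (a : A) ∈ D s} = {b | b ∈ D r ∧ b ∈ D (r * s)}
  θ_comp : ∀ (r s : Γ) (a : A) (h₁ : a ∈ D s⁻¹), a ∈ D (s⁻¹ * r⁻¹) →
    ∃ (h₂ : (θ s ⟨a, h₁⟩ : A) ∈ D r⁻¹) (h₃ : a ∈ D (r * s)⁻¹)
      (h₄ : (θ (r * s) ⟨a, h₃⟩ : A) ∈ D r ⊓ D (r * s)),
      (θ r ⟨θ s ⟨a, h₁⟩, h₂⟩ : A) =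
        ((w r s)⁻¹).val.R ((w r s).val.L ⟨θ (r * s) ⟨a, h₃⟩, h₄⟩)
  w_one_left : ∀ t, w 1 t = 1
  w_one_right : ∀ t, w t 1 = 1
  cocycle : ∀ (r s t : Γ) (a : A) (h₁ : a ∈ D r⁻¹) (h₂ : a ∈ D s ⊓ D (s * t)),
    ∃ (h₃ : ((w s t).val.R ⟨a, h₂⟩ : A) ∈ D r⁻¹)
      (h₄ : (θ r ⟨(w s t).val.R ⟨a, h₂⟩, h₃⟩ : A) ∈ D r ⊓ D (r * (s * t)))
      (h₅ : (θ r ⟨a, h₁⟩ : A) ∈ D r ⊓ D (r * s))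
      (h₆ : ((w r s).val.R ⟨θ r ⟨a, h₁⟩, h₅⟩ : A) ∈ D (r * s) ⊓ D (r * s * t)),
      ((w r (s * t)).val.R ⟨θ r ⟨(w s t).val.R ⟨a, h₂⟩, h₃⟩, h₄⟩ : A) =
        (w (r * s) t).val.R ⟨(w r s).val.R ⟨θ r ⟨a, h₁⟩, h₅⟩, h₆⟩

namespace TwistedPartialAction

variable {F Γ A : Type*} [Field F] [Group Γ] [Ring A] [Algebra F A]
variable (Θ : TwistedPartialAction F Γ A)

theorem θ_mem (r s : Γ) (a : Θ.D r⁻¹) (ha : (a : A) ∈ Θ.D s) :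
    (Θ.θ r a : A) ∈ Θ.D r ⊓ Θ.D (r * s) := by
  have h : (Θ.θ r a : A) ∈ {b | b ∈ Θ.D r ∧ b ∈ Θ.D (r * s)} := by
    rw [← Θ.θ_image]
    exact ⟨a, ha, rfl⟩
  exact h

theorem prod_mem_left (r : Γ) (a : Θ.D r) (b : A) :
    ((Θ.θ r).symm a : A) * b ∈ Θ.D r⁻¹ := by
  have := Θ.two_sided r⁻¹
  exact Ideal.mul_mem_right _ _ ((Θ.θ r).symm a).2

/-- The coefficient of `(a δ_r)(b δ_s)` at `rs`, that is `θ_r(θ_r⁻¹(a) b) w_{r,s}`. -/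
def coeffMul (r s : Γ) (a : Θ.D r) (b : Θ.D s) : Θ.D (r * s) :=
  Submodule.inclusion inf_le_right
    ((Θ.w r s).val.R
      ⟨Θ.θ r ⟨((Θ.θ r).symm a : A) * b, Θ.prod_mem_left r a b⟩,
        Θ.θ_mem r s _ ((Θ.D s).mul_mem_left _ b.2)⟩)

theorem coeffMul_aux_add (r s : Γ) (p q v : Θ.D r⁻¹) (hp : (p : A) ∈ Θ.D s)
    (hq : (q : A) ∈ Θ.D s) (hv : (v : A) ∈ Θ.D s) (h : v = p + q) :
    (Θ.w r s).val.R ⟨Θ.θ r v, Θ.θ_mem r s v hv⟩ =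
      (Θ.w r s).val.R ⟨Θ.θ r p, Θ.θ_mem r s p hp⟩ +
        (Θ.w r s).val.R ⟨Θ.θ r q, Θ.θ_mem r s q hq⟩ := by
  subst h
  rw [← map_add]
  congr 1
  apply Subtype.ext
  simp

theorem coeffMul_aux_smul (r s : Γ) (c : F) (p v : Θ.D r⁻¹) (hp : (p : A) ∈ Θ.D s)
    (hv : (v : A) ∈ Θ.D s) (h : v = c • p) :
    (Θ.w r s).val.R ⟨Θ.θ r v, Θ.θ_mem r s v hv⟩ =
      c • (Θ.w r s).val.R ⟨Θ.θ r p, Θ.θ_mem r s p hp⟩ := by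
  subst h
  rw [← map_smul]
  congr 1
  apply Subtype.ext
  simp

/-- `coeffMul` as a bilinear map. -/
def coeffMulₗ (r s : Γ) : Θ.D r →ₗ[F] Θ.D s →ₗ[F] Θ.D (r * s) :=
  LinearMap.mk₂ F (Θ.coeffMul r s)
    (fun a a' b => Subtype.ext (congrArg (fun z : ↥(Θ.D r ⊓ Θ.D (r * s)) => (z : A))
      (Θ.coeffMul_aux_add r s
        ⟨((Θ.θ r).symm a : A) * (b : Θ.D s), Θ.prod_mem_left r a _⟩
        ⟨((Θ.θ r).symm a' : A) * (b : Θ.D s), Θ.prod_mem_left r a' _⟩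
        ⟨((Θ.θ r).symm (a + a') : A) * (b : Θ.D s), Θ.prod_mem_left r (a + a') _⟩
        ((Θ.D s).mul_mem_left _ (Subtype.prop (b))) ((Θ.D s).mul_mem_left _ (Subtype.prop (b))) ((Θ.D s).mul_mem_left _ (Subtype.prop (b)))
        (Subtype.ext (by simp [add_mul])))))
    (fun c a b => Subtype.ext (congrArg (fun z : ↥(Θ.D r ⊓ Θ.D (r * s)) => (z : A))
      (Θ.coeffMul_aux_smul r s c
        ⟨((Θ.θ r).symm a : A) * (b : Θ.D s), Θ.prod_mem_left r a _⟩
        ⟨((Θ.θ r).symm (c • a) : A) * (b : Θ.D s), Θ.prod_mem_left r (c • a) _⟩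
        ((Θ.D s).mul_mem_left _ (Subtype.prop (b))) ((Θ.D s).mul_mem_left _ (Subtype.prop (b)))
        (Subtype.ext (by simp)))))
    (fun a b b' => Subtype.ext (congrArg (fun z : ↥(Θ.D r ⊓ Θ.D (r * s)) => (z : A))
      (Θ.coeffMul_aux_add r s
        ⟨((Θ.θ r).symm a : A) * (b : Θ.D s), Θ.prod_mem_left r a _⟩
        ⟨((Θ.θ r).symm a : A) * (b' : Θ.D s), Θ.prod_mem_left r a _⟩
        ⟨((Θ.θ r).symm a : A) * (b + b' : Θ.D s), Θ.prod_mem_left r a _⟩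
        ((Θ.D s).mul_mem_left _ (Subtype.prop (b))) ((Θ.D s).mul_mem_left _ (Subtype.prop (b'))) ((Θ.D s).mul_mem_left _ (Subtype.prop (b + b')))
        (Subtype.ext (by simp [mul_add])))))
    (fun c a b => Subtype.ext (congrArg (fun z : ↥(Θ.D r ⊓ Θ.D (r * s)) => (z : A))
      (Θ.coeffMul_aux_smul r s c
        ⟨((Θ.θ r).symm a : A) * (b : Θ.D s), Θ.prod_mem_left r a _⟩
        ⟨((Θ.θ r).symm a : A) * (c • b : Θ.D s), Θ.prod_mem_left r a _⟩
        ((Θ.D s).mul_mem_left _ (Subtype.prop (b))) ((Θ.D s).mul_mem_left _ (Subtype.prop (c • b)))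
        (Subtype.ext (by simp)))))

/-- The crossed product `A ⋊ Γ`: the direct sum of the ideals `D_t`, `t ∈ Γ`. -/
def CrossedProduct : Type _ := DirectSum Γ fun t => Θ.D t

instance : AddCommGroup Θ.CrossedProduct :=
  inferInstanceAs (AddCommGroup (DirectSum Γ fun t => Θ.D t))

instance : Module F Θ.CrossedProduct :=
  inferInstanceAs (Module F (DirectSum Γ fun t => Θ.D t))

open scoped Classical in
/-- The element `a δ_t` of the crossed product, for `a ∈ D_t`. -/
def delta (t : Γ) : Θ.D t →ₗ[F] Θ.CrossedProduct :=
  DirectSum.lof F Γ (fun t => Θ.D t) t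

open scoped Classical in
/-- The multiplication of the crossed product, the bilinear map with
`(a δ_r)(b δ_s) = θ_r(θ_r⁻¹(a) b) w_{r,s} δ_{rs}`; see `delta_mul_delta`. -/
def mulₗ : Θ.CrossedProduct →ₗ[F] Θ.CrossedProduct →ₗ[F] Θ.CrossedProduct :=
  DirectSum.toModule F Γ (Θ.CrossedProduct →ₗ[F] Θ.CrossedProduct) fun r =>
    LinearMap.flip <|
      DirectSum.toModule F Γ (Θ.D r →ₗ[F] Θ.CrossedProduct) fun s =>
        LinearMap.flip ((Θ.coeffMulₗ r s).compr₂ (Θ.delta (r * s)))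

instance : Mul Θ.CrossedProduct := ⟨fun a b => Θ.mulₗ a b⟩

/-- For an arbitrary twisted partial action the crossed product need not be associative or
unital. -/
instance : NonUnitalNonAssocRing Θ.CrossedProduct where
  left_distrib a b c := (Θ.mulₗ a).map_add b c
  right_distrib a b c := Θ.mulₗ.map_add₂ a b c
  zero_mul a := Θ.mulₗ.map_zero₂ a
  mul_zero a := (Θ.mulₗ a).map_zero

theorem delta_mul_delta (r s : Γ) (a : Θ.D r) (b : Θ.D s) :
    Θ.delta r a * Θ.delta s b = Θ.delta (r * s) (Θ.coeffMul r s a b) := by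
  classical
  have h₁ := DirectSum.toModule_lof (M := fun t => Θ.D t)
    (φ := fun r => LinearMap.flip <|
      DirectSum.toModule F Γ (Θ.D r →ₗ[F] Θ.CrossedProduct) fun s =>
        LinearMap.flip ((Θ.coeffMulₗ r s).compr₂ (Θ.delta (r * s)))) F r a
  have h₂ := DirectSum.toModule_lof (M := fun t => Θ.D t)
    (φ := fun s => LinearMap.flip ((Θ.coeffMulₗ r s).compr₂ (Θ.delta (r * s)))) F s b
  have h₃ := LinearMap.congr_fun h₁ (Θ.delta s b)
  have h₄ := LinearMap.congr_fun h₂ a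
  exact h₃.trans h₄

end TwistedPartialAction

end HeckeCrossed

end

/-! Everything rests on one product formula, `sigma_mul_sigma`: σ_x σ_y = e_x σ_{xy}, where e_x in
F[N/H] is the average of the image of xHx⁻¹ in N/H. Conjugation by N permutes the classes being
averaged, because N normalizes H, so e_x is central. Thus x ↦ σ_x is a partial representation of G
with central idempotents e_x = σ_x σ_{x⁻¹}, and on N it is an honest homomorphism.

From such data, isolated in `CovariantPair`, the twisted partial action is formal: conjugation by
σ_x carries the ideal of e_{x⁻¹} onto that of e_x, the idempotent e_x depends only on xN, and ξ
fails to be multiplicative only by elements of N, whose σ is invertible.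

The isomorphism is aδ_t ↦ a σ_{ξ(t)}. It is multiplicative by `ι_coeffMul`; it is onto because σ_x =
σ_n σ_{ξ(xN)} with n in N; it is injective because a σ_{ξ(t)} shifts cosets of N by t, so different
t produce disjoint supports (`hecke_independent`). -/

noncomputable section

namespace HeckeCrossed

/-! ### Multipliers coming from elements of the algebra. -/

section MultiplierOfElement

variable (F : Type*) {A : Type*} [Field F] [Ring A] [Algebra F A]

/-- An element of `A` acts on each two-sided ideal as a multiplier. -/
def Multiplier.ofElement (I : Ideal A) [I.IsTwoSided] (u : A) : Multiplier F I where
  L := { toFun := fun a => ⟨u * a, I.mul_mem_left u a.2⟩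
         map_add' := fun a b => Subtype.ext (by simp [mul_add])
         map_smul' := fun c a => Subtype.ext (by simp) }
  R := { toFun := fun a => ⟨a * u, I.mul_mem_right u a.2⟩
         map_add' := fun a b => Subtype.ext (by simp [add_mul])
         map_smul' := fun c a => Subtype.ext (by simp) }
  L_mul a b := Subtype.ext (by simp [mul_assoc])
  R_mul a b := Subtype.ext (by simp [mul_assoc])
  R_mul_eq a b := Subtype.ext (by simp [mul_assoc])

theorem Multiplier.ofElement_one (I : Ideal A) [I.IsTwoSided] :
    Multiplier.ofElement F I 1 = 1 := by
  apply Multiplier.ext <;> ext a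
  · exact one_mul (a : A)
  · exact mul_one (a : A)

theorem Multiplier.ofElement_mul (I : Ideal A) [I.IsTwoSided] (u v : A) :
    Multiplier.ofElement F I (u * v) = Multiplier.ofElement F I u * Multiplier.ofElement F I v := by
  apply Multiplier.ext <;> ext a
  · exact mul_assoc u v (a : A)
  · exact (mul_assoc (a : A) u v).symm

/-- Elements of `A` as multipliers of a two-sided ideal, as a homomorphism. -/
def Multiplier.ofElementHom (I : Ideal A) [I.IsTwoSided] : A →* Multiplier F I where
  toFun := Multiplier.ofElement F I
  map_one' := Multiplier.ofElement_one F I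
  map_mul' := Multiplier.ofElement_mul F I

end MultiplierOfElement

theorem isTwoSided_inf {A : Type*} [Ring A] (I J : Ideal A) [I.IsTwoSided] [J.IsTwoSided] :
    (I ⊓ J).IsTwoSided :=
  ⟨fun b h => ⟨I.mul_mem_right b h.1, J.mul_mem_right b h.2⟩⟩

/-! ### Linear maps out of a crossed product. -/

namespace TwistedPartialAction

variable {F Γ A M : Type*} [Field F] [Group Γ] [Ring A] [Algebra F A] [AddCommMonoid M]
  [Module F M]
  (Θ : TwistedPartialAction F Γ A)

open scoped Classical in
/-- The linear map on the crossed product defined by linear maps on the summands. -/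
def lift (f : ∀ t, Θ.D t →ₗ[F] M) : Θ.CrossedProduct →ₗ[F] M :=
  DirectSum.toModule F Γ M f

theorem lift_delta (f : ∀ t, Θ.D t →ₗ[F] M) (t : Γ) (a : Θ.D t) :
    Θ.lift f (Θ.delta t a) = f t a := by
  classical
  exact DirectSum.toModule_lof (M := fun t => Θ.D t) F t a

variable {Θ}

theorem linearMap_ext {f g : Θ.CrossedProduct →ₗ[F] M}
    (h : ∀ t a, f (Θ.delta t a) = g (Θ.delta t a)) : f = g := by
  classical
  exact DirectSum.linearMap_ext F fun t => LinearMap.ext (h t)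

theorem exists_eq_sum_delta (d : Θ.CrossedProduct) :
    ∃ (S : Finset Γ) (a : ∀ t, Θ.D t), d = ∑ t ∈ S, Θ.delta t (a t) := by
  classical
  let d' : DirectSum Γ fun t => Θ.D t := d
  exact ⟨DFinsupp.support d', fun t => d' t, (DirectSum.sum_support_of d').symm⟩

end TwistedPartialAction

/-! ### Partial representations and their twisted partial actions. -/

/-- A homomorphism `ι : A → R` of algebras with a partial representation `s` of `G` in `R`, whose
restriction to the normal subgroup `N` comes from a homomorphism `u` from `N` to `A`, and whose
idempotents come from central elements of `A`. -/
structure CovariantPair (F A R : Type*) {G : Type*} [Field F] [Ring A] [Algebra F A] [Semiring R]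
    [Algebra F R] [Group G] (N : Subgroup G) where
  /-- the embedding of the coefficient algebra -/
  ι : A →ₐ[F] R
  ι_injective : Function.Injective ι
  /-- the partial representation -/
  s : G → R
  /-- the elements of `A` representing `N` -/
  u : N →* A
  /-- the elements of `A` mapping to the idempotents `s x * s x⁻¹` -/
  e : G → A
  ι_u : ∀ n, ι (u n) = s n
  e_comm : ∀ x a, e x * a = a * e x
  s_mul : ∀ x y, s x * s y = ι (e x) * s (x * y)
  span_u : Submodule.span F (Set.range u) = ⊤

namespace CovariantPair

variable {F A R G : Type*} [Field F] [Ring A] [Algebra F A] [Semiring R] [Algebra F R] [Group G]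
  {N : Subgroup G} (P : CovariantPair F A R N)

theorem s_one : P.s 1 = 1 := by
  have := P.ι_u 1
  simpa using this.symm

theorem ι_e (x : G) : P.ι (P.e x) = P.s x * P.s x⁻¹ := by
  rw [P.s_mul, mul_inv_cancel, P.s_one, mul_one]

theorem e_mul_s (x : G) : P.ι (P.e x) * P.s x = P.s x := by
  have := P.s_mul x 1
  rw [P.s_one, mul_one, mul_one] at this
  exact this.symm

theorem e_mul_self (x : G) : P.e x * P.e x = P.e x := by
  apply P.ι_injective
  rw [map_mul]
  nth_rewrite 2 [P.ι_e]
  rw [← mul_assoc, P.e_mul_s, P.ι_e]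

theorem ι_e_comm (x : G) (a : A) : P.ι (P.e x) * P.ι a = P.ι a * P.ι (P.e x) := by
  rw [← map_mul, P.e_comm, map_mul]

/-- Mirror image of `s_mul`. Expanding `s (x * y) * s y⁻¹ * s y` from the left gives `e (x * y)` and
`e x` times `s (x * y)`; by centrality `e (x * y)` moves next to `s (x * y)` and is absorbed. -/
theorem s_mul_eq_mul_e (x y : G) : P.s x * P.s y = P.s (x * y) * P.ι (P.e y⁻¹) := by
  rw [P.ι_e, inv_inv, ← mul_assoc, P.s_mul (x * y), mul_inv_cancel_right, mul_assoc, P.s_mul x,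
    ← mul_assoc, P.ι_e_comm, mul_assoc, P.e_mul_s]

theorem s_mul_e (x : G) : P.s x * P.ι (P.e x⁻¹) = P.s x := by
  have := P.s_mul_eq_mul_e 1 x
  rw [P.s_one, one_mul, one_mul] at this
  exact this.symm

/-- `u` is a homomorphism on the group N, so `s n` is invertible with inverse `s n⁻¹`. Consequently
`s` is strictly multiplicative as soon as one factor lies in N. -/
theorem e_of_mem {n : G} (hn : n ∈ N) : P.e n = 1 := by
  apply P.ι_injective
  have h₁ := P.ι_u ⟨n, hn⟩
  have h₂ := P.ι_u ⟨n, hn⟩⁻¹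
  simp only [Subgroup.coe_inv] at h₁ h₂
  rw [P.ι_e, ← h₁, ← h₂, ← map_mul, ← map_mul, mul_inv_cancel, map_one]

theorem s_mul_of_mem_left {n : G} (hn : n ∈ N) (x : G) : P.s n * P.s x = P.s (n * x) := by
  rw [P.s_mul, P.e_of_mem hn, map_one, one_mul]

theorem s_mul_of_mem_right {n : G} (hn : n ∈ N) (x : G) : P.s x * P.s n = P.s (x * n) := by
  rw [P.s_mul_eq_mul_e, P.e_of_mem (N.inv_mem hn), map_one, mul_one]

/-- With y = xn, the unit `s n` cancels in `s y * s y⁻¹`. This makes the ideals depend on cosets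
only, so that ξ(t⁻¹) can be traded for ξ(t)⁻¹ and ξ(st) for ξ(s)ξ(t). -/
theorem e_eq_of_mk_eq {x y : G} (h : (x : G ⧸ N) = y) : P.e x = P.e y := by
  have hn : x⁻¹ * y ∈ N := QuotientGroup.eq.1 h
  apply P.ι_injective
  have h₁ : P.s y = P.s x * P.s (x⁻¹ * y) := by
    rw [P.s_mul_of_mem_right hn, mul_inv_cancel_left]
  have h₂ : P.s y⁻¹ = P.s (x⁻¹ * y)⁻¹ * P.s x⁻¹ := by
    rw [P.s_mul_of_mem_left (N.inv_mem hn)]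
    simp
  have h₃ : P.s (x⁻¹ * y) * P.s (x⁻¹ * y)⁻¹ = 1 := by
    rw [← P.ι_e, P.e_of_mem hn, map_one]
  rw [P.ι_e, P.ι_e, h₁, h₂, mul_assoc, ← mul_assoc (P.s (x⁻¹ * y)), h₃, one_mul]

/-- On generators, s(x)s(n)s(x⁻¹) = e(xn) s(xnx⁻¹), and xnx⁻¹ is again in N; linearity does the
rest. -/
theorem exists_conj [N.Normal] (x : G) (a : A) : ∃ b, P.ι b = P.s x * P.ι a * P.s x⁻¹ := by
  have ha : a ∈ Submodule.span F (Set.range P.u) := by rw [P.span_u]; trivial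
  induction ha using Submodule.span_induction with
  | mem a h =>
    obtain ⟨n, rfl⟩ := h
    refine ⟨P.e (x * n) * P.u ⟨x * n * x⁻¹, Subgroup.Normal.conj_mem inferInstance _ n.2 x⟩, ?_⟩
    rw [P.ι_u, P.s_mul_of_mem_right n.2, P.s_mul, map_mul, P.ι_u]
  | zero => exact ⟨0, by simp⟩
  | add a b _ _ ha hb =>
    obtain ⟨a', ha⟩ := ha
    obtain ⟨b', hb⟩ := hb
    exact ⟨a' + b', by rw [map_add, ha, hb, map_add, mul_add, add_mul]⟩
  | smul c a _ ha =>
    obtain ⟨a', ha⟩ := ha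
    exact ⟨c • a', by rw [map_smul, ha, map_smul, mul_smul_comm, smul_mul_assoc]⟩

variable [N.Normal]

/-- The map `a ↦ s x * a * s x⁻¹` on `A`. -/
def conj (x : G) : A →ₗ[F] A where
  toFun a := (P.exists_conj x a).choose
  map_add' a b := P.ι_injective <| by
    refine (P.exists_conj x (a + b)).choose_spec.trans ?_
    rw [map_add P.ι a b, mul_add, add_mul]
    exact ((map_add P.ι _ _).trans (congrArg₂ _ (P.exists_conj x a).choose_spec
      (P.exists_conj x b).choose_spec)).symm
  map_smul' c a := P.ι_injective <| by
    refine (P.exists_conj x (c • a)).choose_spec.trans ?_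
    rw [map_smul P.ι c a, mul_smul_comm, smul_mul_assoc]
    exact ((map_smul P.ι c _).trans (congrArg _ (P.exists_conj x a).choose_spec)).symm

theorem ι_conj (x : G) (a : A) : P.ι (P.conj x a) = P.s x * P.ι a * P.s x⁻¹ :=
  (P.exists_conj x a).choose_spec

/-- Collapsing s(x)s(y)s(y⁻¹)s(x⁻¹) from the left yields e(x)e(xy)e(x). This is the source of
postulate (ii). -/
theorem conj_e (x y : G) : P.conj x (P.e y) = P.e x * P.e (x * y) := by
  apply P.ι_injective
  rw [P.ι_conj, P.ι_e y, ← mul_assoc, P.s_mul x y, mul_assoc (_ * _), mul_assoc,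
    ← mul_assoc (P.s (x * y)), P.s_mul (x * y), mul_inv_cancel_right, mul_assoc _ (P.s x),
    ← P.ι_e, ← map_mul, ← map_mul, ← P.e_comm x, ← mul_assoc, P.e_mul_self]

/-- Conjugation is multiplicative on elements fixed by the idempotent. -/
theorem conj_mul (x : G) {a : A} (ha : a * P.e x⁻¹ = a) (b : A) :
    P.conj x (a * b) = P.conj x a * P.conj x b := by
  apply P.ι_injective
  rw [map_mul P.ι (P.conj x a), P.ι_conj, P.ι_conj, P.ι_conj]
  nth_rewrite 1 [← ha]
  rw [map_mul, map_mul, P.ι_e, inv_inv]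
  simp only [mul_assoc]

theorem conj_one (a : A) : P.conj 1 a = a := by
  apply P.ι_injective
  rw [P.ι_conj, inv_one, P.s_one, one_mul, mul_one]

theorem conj_inv_conj (x : G) {a : A} (ha : a * P.e x⁻¹ = a) : P.conj x⁻¹ (P.conj x a) = a := by
  apply P.ι_injective
  have h : P.ι a * (P.s x⁻¹ * P.s x) = P.ι a := by
    have := congrArg P.ι ha
    rwa [map_mul, P.ι_e, inv_inv] at this
  have h' : P.s x⁻¹ * P.s x * P.ι a = P.ι a := by
    have := P.ι_e_comm x⁻¹ a
    rw [P.ι_e, inv_inv] at this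
    rw [this, h]
  rw [P.ι_conj, P.ι_conj, inv_inv]
  calc _ = (P.s x⁻¹ * P.s x * P.ι a) * (P.s x⁻¹ * P.s x) := by simp only [mul_assoc]
    _ = _ := by rw [h', h]

/-- If `a` is fixed by `e (x⁻¹)` and by `e y`, its conjugate is fixed by `e x` and `e (x * y)`. -/
theorem conj_mul_e (x y : G) {a : A} (ha : a * P.e x⁻¹ = a) (hy : a * P.e y = a) :
    P.conj x a * P.e (x * y) = P.conj x a := by
  have h : P.conj x a * P.e x = P.conj x a := by
    apply P.ι_injective
    rw [← P.e_comm, map_mul, P.ι_conj, ← mul_assoc, ← mul_assoc, P.e_mul_s]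
  conv_rhs => rw [← hy, P.conj_mul x ha, P.conj_e, ← mul_assoc, h]

/-- Conjugating by `x * y` when `x * y = n * z` with `n ∈ N`. -/
theorem conj_conj (x y z : G) (n : N) (hn : x * y = n * z) {a : A} (ha : a * P.e y⁻¹ = a) :
    P.conj x (P.conj y a) = P.u n * P.conj z a * P.u n⁻¹ := by
  apply P.ι_injective
  have h₁ : P.s x * P.s y * P.ι a = P.s (x * y) * P.ι a := by
    rw [P.s_mul_eq_mul_e, mul_assoc, ← map_mul, P.e_comm, ha]
  have h₂ : P.ι a * (P.s y⁻¹ * P.s x⁻¹) = P.ι a * P.s (x * y)⁻¹ := by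
    rw [P.s_mul, ← mul_assoc, ← map_mul, ha, mul_inv_rev]
  have h₃ : P.s (x * y) = P.s n * P.s z := by rw [P.s_mul_of_mem_left n.2, hn]
  have h₄ : P.s (x * y)⁻¹ = P.s z⁻¹ * P.s (n⁻¹ : N) := by
    rw [P.s_mul_of_mem_right (n⁻¹ : N).2, hn, mul_inv_rev, Subgroup.coe_inv]
  rw [map_mul, map_mul, P.ι_conj, P.ι_conj, P.ι_conj, P.ι_u, P.ι_u]
  calc _ = (P.s x * P.s y * P.ι a) * (P.s y⁻¹ * P.s x⁻¹) := by simp only [mul_assoc]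
    _ = P.s (x * y) * P.ι a * P.s (x * y)⁻¹ := by rw [h₁, mul_assoc, h₂, mul_assoc]
    _ = _ := by rw [h₃, h₄]; simp only [mul_assoc]

/-- The ideal of `A` generated by `e x`. -/
def ideal (x : G) : Ideal A := Ideal.span {P.e x}

omit [N.Normal] in
-- The generator is a central idempotent, so membership is a fixed-point equation; all later
-- computations use this form.
theorem mem_ideal {x : G} {a : A} : a ∈ P.ideal x ↔ a * P.e x = a := by
  rw [ideal, Ideal.mem_span_singleton']
  constructor
  · rintro ⟨b, rfl⟩
    rw [mul_assoc, P.e_mul_self]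
  · intro h
    exact ⟨a, h⟩

omit [N.Normal] in
theorem ideal_isTwoSided (x : G) : (P.ideal x).IsTwoSided :=
  ⟨fun b h => by
    rw [mem_ideal] at h ⊢
    rw [mul_assoc, ← P.e_comm, ← mul_assoc, h]⟩

variable (ξ : G ⧸ N → G)

instance (x : G) : (P.ideal x).IsTwoSided := P.ideal_isTwoSided x

instance (x y : G) : (P.ideal x ⊓ P.ideal y).IsTwoSided := isTwoSided_inf _ _

/-- The unit of `A` defined by an element of `N`. -/
def unit (n : N) : Aˣ := Units.map P.u (toUnits n)

variable {ξ} (hξ : ∀ t : G ⧸ N, (ξ t : G ⧸ N) = t)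

include hξ

omit [N.Normal] in
theorem mem_ideal_section {x : G} {t : G ⧸ N} (h : (x : G ⧸ N) = t) {a : A} :
    a ∈ P.ideal (ξ t) ↔ a * P.e x = a := by
  rw [mem_ideal, P.e_eq_of_mk_eq ((hξ t).trans h.symm)]

theorem mem_ideal_section_inv {t : G ⧸ N} {a : A} :
    a ∈ P.ideal (ξ t⁻¹) ↔ a * P.e (ξ t)⁻¹ = a :=
  P.mem_ideal_section hξ (by rw [QuotientGroup.mk_inv, hξ])

theorem mem_ideal_section_mul {s t : G ⧸ N} {a : A} :
    a ∈ P.ideal (ξ (s * t)) ↔ a * P.e (ξ s * ξ t) = a :=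
  P.mem_ideal_section hξ (by rw [QuotientGroup.mk_mul, hξ, hξ])

theorem section_cocycle_mem (r s : G ⧸ N) : ξ r * ξ s * (ξ (r * s))⁻¹ ∈ N := by
  rw [← QuotientGroup.eq_one_iff, QuotientGroup.mk_mul, QuotientGroup.mk_inv,
    QuotientGroup.mk_mul, hξ, hξ, hξ, mul_inv_cancel]

theorem conj_section_mem {t : G ⧸ N} {a : A} (ha : a ∈ P.ideal (ξ t⁻¹)) :
    P.conj (ξ t) a ∈ P.ideal (ξ t) := by
  rw [P.mem_ideal_section_inv hξ] at ha
  rw [mem_ideal]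
  have := P.conj_mul_e (ξ t) 1 ha (by rw [P.e_of_mem N.one_mem, mul_one])
  rwa [mul_one] at this

theorem conj_section_mem' {r s : G ⧸ N} {a : A} (ha : a ∈ P.ideal (ξ r⁻¹))
    (hs : a ∈ P.ideal (ξ s)) : P.conj (ξ r) a ∈ P.ideal (ξ r) ⊓ P.ideal (ξ (r * s)) := by
  exact ⟨P.conj_section_mem hξ ha, (P.mem_ideal_section_mul hξ).2
    (P.conj_mul_e _ _ ((P.mem_ideal_section_inv hξ).1 ha) (P.mem_ideal.1 hs))⟩

theorem conj_inv_section_mem {t : G ⧸ N} {a : A} (ha : a ∈ P.ideal (ξ t)) :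
    P.conj (ξ t)⁻¹ a ∈ P.ideal (ξ t⁻¹) := by
  rw [P.mem_ideal] at ha
  rw [P.mem_ideal_section_inv hξ]
  have := P.conj_mul_e (ξ t)⁻¹ 1 (by rwa [inv_inv]) (by rw [P.e_of_mem N.one_mem, mul_one])
  rwa [mul_one] at this

/-- The isomorphisms of the twisted partial action. -/
def conjEquiv (t : G ⧸ N) : P.ideal (ξ t⁻¹) ≃ₗ[F] P.ideal (ξ t) where
  toFun a := ⟨P.conj (ξ t) a, P.conj_section_mem hξ a.2⟩
  invFun a := ⟨P.conj (ξ t)⁻¹ a, P.conj_inv_section_mem hξ a.2⟩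
  map_add' a b := Subtype.ext (by simp)
  map_smul' c a := Subtype.ext (by simp)
  left_inv a := Subtype.ext (P.conj_inv_conj _ ((P.mem_ideal_section_inv hξ).1 a.2))
  right_inv a := Subtype.ext (by
    have := P.conj_inv_conj (ξ t)⁻¹ (a := a) (by rw [inv_inv]; exact P.mem_ideal.1 a.2)
    rwa [inv_inv] at this)

/-- The element of `N` that measures the failure of `ξ` to be multiplicative. -/
def sectionCocycle (r s : G ⧸ N) : N :=
  ⟨ξ r * ξ s * (ξ (r * s))⁻¹, section_cocycle_mem hξ r s⟩

/-- The twisted partial action of `G ⧸ N` on `A` defined by a section of the quotient map. -/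
def twistedPartialAction (hξ_one : ξ 1 = 1) : TwistedPartialAction F (G ⧸ N) A where
  D t := P.ideal (ξ t)
  two_sided t := inferInstance
  θ := P.conjEquiv hξ
  θ_mul t a b := Subtype.ext (P.conj_mul _ ((P.mem_ideal_section_inv hξ).1 a.2) _)
  w r s := Units.map (Multiplier.ofElementHom F (P.ideal (ξ r) ⊓ P.ideal (ξ (r * s))))
    (P.unit (sectionCocycle hξ r s))
  D_one := by
    rw [hξ_one, Ideal.eq_top_iff_one, mem_ideal, P.e_of_mem N.one_mem, mul_one]
  θ_one a := by
    change P.conj (ξ 1) a = a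
    rw [hξ_one, P.conj_one]
  θ_image r s := by
    ext b
    constructor
    · rintro ⟨a, ha, rfl⟩
      exact P.conj_section_mem' hξ a.2 ha
    · rintro ⟨hr, hs⟩
      refine ⟨(P.conjEquiv hξ r).symm ⟨b, hr⟩, ?_,
        congrArg Subtype.val ((P.conjEquiv hξ r).apply_symm_apply ⟨b, hr⟩)⟩
      -- Surjectivity is the forward inclusion for the inverse conjugation, since ξ(r)⁻¹ · ξ(r)ξ(s)
      -- = ξ(s).
      change P.conj (ξ r)⁻¹ b ∈ P.ideal (ξ s)
      rw [P.mem_ideal] at hr ⊢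
      rw [P.mem_ideal_section_mul hξ] at hs
      have := P.conj_mul_e (ξ r)⁻¹ (ξ r * ξ s) (by rwa [inv_inv]) hs
      rwa [inv_mul_cancel_left] at this
  θ_comp r s a h₁ h := by
    rw [← mul_inv_rev] at h
    refine ⟨?_, h, ?_, ?_⟩
    -- Both memberships are instances of postulate (ii): s(rs)⁻¹ = r⁻¹ here, and (rs)s⁻¹ = r next.
    · have := (P.conj_section_mem' hξ h₁ h).2
      rwa [mul_inv_rev, mul_inv_cancel_left] at this
    · have := P.conj_section_mem' hξ h h₁
      rw [mul_inv_cancel_right] at this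
      exact this.symm
    · exact P.conj_conj _ _ _ (sectionCocycle hξ r s) (by simp [sectionCocycle])
        ((P.mem_ideal_section_inv hξ).1 h₁)
  w_one_left t := by
    have : sectionCocycle hξ 1 t = 1 := Subtype.ext (by simp [sectionCocycle, hξ_one])
    rw [this, unit, map_one, map_one, map_one]
  w_one_right t := by
    have : sectionCocycle hξ t 1 = 1 := Subtype.ext (by simp [sectionCocycle, hξ_one])
    rw [this, unit, map_one, map_one, map_one]
  cocycle r s t a h₁ h₂ := by
    have h₃ : a * P.u (sectionCocycle hξ s t) ∈ P.ideal (ξ r⁻¹) := Ideal.mul_mem_right _ _ h₁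
    have h₄ : a * P.u (sectionCocycle hξ s t) ∈ P.ideal (ξ (s * t)) :=
      Ideal.mul_mem_right _ _ h₂.2
    have h₅ := P.conj_section_mem' hξ h₁ h₂.1
    have h₆ := (P.conj_section_mem' hξ h₁ h₂.2).2
    rw [← mul_assoc] at h₆
    refine ⟨h₃, P.conj_section_mem' hξ h₃ h₄, h₅,
      ⟨Ideal.mul_mem_right _ _ h₅.2, Ideal.mul_mem_right _ _ h₆⟩, ?_⟩
    change P.conj (ξ r) (a * P.u (sectionCocycle hξ s t)) * P.u (sectionCocycle hξ r (s * t)) =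
      P.conj (ξ r) a * P.u (sectionCocycle hξ r s) * P.u (sectionCocycle hξ (r * s) t)
    -- To the right of s(ξ(r)) a, every product has a factor in N, so no idempotent appears; both
    -- sides collapse to s(ξ(s)ξ(t)ξ(rst)⁻¹).
    apply P.ι_injective
    simp only [map_mul, P.ι_conj, P.ι_u, mul_assoc]
    rw [P.s_mul_of_mem_right (sectionCocycle hξ r (s * t)).2,
      P.s_mul_of_mem_left (sectionCocycle hξ s t).2,
      P.s_mul_of_mem_right (sectionCocycle hξ (r * s) t).2,
      P.s_mul_of_mem_right (N.mul_mem (sectionCocycle hξ r s).2 (sectionCocycle hξ (r * s) t).2)]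
    simp [sectionCocycle, mul_assoc]

variable (hξ_one : ξ 1 = 1)

/-- For a = θ_r(p), both sides equal s(ξ(r)) p b s(ξ(s)): the leftover idempotent e(ξ(r)⁻¹) is
absorbed by p. -/
theorem ι_coeffMul (r s : G ⧸ N) (a : P.ideal (ξ r)) (b : P.ideal (ξ s)) :
    P.ι ((P.twistedPartialAction hξ hξ_one).coeffMul r s a b : A) * P.s (ξ (r * s)) =
      P.ι a * P.s (ξ r) * (P.ι b * P.s (ξ s)) := by
  obtain ⟨p, rfl⟩ := (P.conjEquiv hξ r).surjective a
  have hp : ((P.conjEquiv hξ r).symm (P.conjEquiv hξ r p) : A) = p := by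
    rw [LinearEquiv.symm_apply_apply]
  change P.ι (P.conj (ξ r) (((P.conjEquiv hξ r).symm (P.conjEquiv hξ r p) : A) * b) *
    P.u (sectionCocycle hξ r s)) * P.s (ξ (r * s)) =
      P.ι (P.conj (ξ r) p) * P.s (ξ r) * (P.ι b * P.s (ξ s))
  have h : P.ι p * P.ι (P.e (ξ r)⁻¹) = P.ι p := by
    rw [← map_mul, (P.mem_ideal_section_inv hξ).1 p.2]
  have h₁ : P.s (sectionCocycle hξ r s) * P.s (ξ (r * s)) = P.s (ξ r * ξ s) := by
    rw [P.s_mul_of_mem_left (sectionCocycle hξ r s).2]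
    simp [sectionCocycle]
  have h₂ : P.s (ξ r)⁻¹ * P.s (ξ r * ξ s) = P.ι (P.e (ξ r)⁻¹) * P.s (ξ s) := by
    rw [P.s_mul, inv_mul_cancel_left]
  have h₃ : P.s (ξ r)⁻¹ * P.s (ξ r) = P.ι (P.e (ξ r)⁻¹) := by rw [P.ι_e, inv_inv]
  rw [hp, map_mul, P.ι_conj, P.ι_conj, P.ι_u, map_mul]
  calc _ = P.s (ξ r) * P.ι p * P.ι b * (P.s (ξ r)⁻¹ *
        (P.s (sectionCocycle hξ r s) * P.s (ξ (r * s)))) := by simp only [mul_assoc]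
    _ = P.s (ξ r) * (P.ι p * P.ι (P.e (ξ r)⁻¹)) * P.ι b * P.s (ξ s) := by
      rw [h₁, h₂, ← mul_assoc, mul_assoc _ (P.ι b), ← P.ι_e_comm]
      simp only [mul_assoc]
    _ = _ := by
      rw [← h₃]
      simp only [mul_assoc]

/-- The map `a δ_t ↦ a * s (ξ t)` from the crossed product. -/
def crossedProductMap : (P.twistedPartialAction hξ hξ_one).CrossedProduct →ₗ[F] R :=
  (P.twistedPartialAction hξ hξ_one).lift fun t =>
    (LinearMap.mulRight F (P.s (ξ t))) ∘ₗ P.ι.toLinearMap ∘ₗ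
      ((P.ideal (ξ t)).restrictScalars F).subtype

theorem crossedProductMap_delta (t : G ⧸ N) (a : (P.twistedPartialAction hξ hξ_one).D t) :
    P.crossedProductMap hξ hξ_one ((P.twistedPartialAction hξ hξ_one).delta t a) =
      P.ι a * P.s (ξ t) :=
  TwistedPartialAction.lift_delta _ _ t a

theorem crossedProductMap_mul (a b : (P.twistedPartialAction hξ hξ_one).CrossedProduct) :
    P.crossedProductMap hξ hξ_one (a * b) =
      P.crossedProductMap hξ hξ_one a * P.crossedProductMap hξ hξ_one b := by
  have h : (P.twistedPartialAction hξ hξ_one).mulₗ.compr₂ (P.crossedProductMap hξ hξ_one) =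
      (LinearMap.mul F R).compl₁₂ (P.crossedProductMap hξ hξ_one)
        (P.crossedProductMap hξ hξ_one) := by
    refine TwistedPartialAction.linearMap_ext fun r a => ?_
    refine TwistedPartialAction.linearMap_ext fun s b => ?_
    have h₁ := congrArg (P.crossedProductMap hξ hξ_one)
      ((P.twistedPartialAction hξ hξ_one).delta_mul_delta r s a b)
    refine h₁.trans ?_
    rw [P.crossedProductMap_delta, LinearMap.compl₁₂_apply, LinearMap.mul_apply',
      P.crossedProductMap_delta, P.crossedProductMap_delta]
    exact P.ι_coeffMul hξ hξ_one r s a b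
  exact LinearMap.congr_fun (LinearMap.congr_fun h a) b

/-- The crossed product embeds if the subspaces `A * s (ξ t)` are independent. -/
theorem crossedProductMap_injective
    (indep : ∀ (S : Finset (G ⧸ N)) (a : G ⧸ N → A), ∑ t ∈ S, P.ι (a t) * P.s (ξ t) = 0 →
      ∀ t ∈ S, P.ι (a t) * P.s (ξ t) = 0) :
    Function.Injective (P.crossedProductMap hξ hξ_one) := by
  rw [injective_iff_map_eq_zero]
  intro d hd
  obtain ⟨S, a, rfl⟩ := TwistedPartialAction.exists_eq_sum_delta d
  rw [map_sum] at hd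
  simp only [P.crossedProductMap_delta] at hd
  refine Finset.sum_eq_zero fun t ht => ?_
  -- Since a_t is fixed by e(ξ(t)) = s(ξ(t))s(ξ(t)⁻¹), it vanishes once a_t s(ξ(t)) does.
  have ha : P.ι (a t : A) = 0 := by
    have h := congrArg P.ι (P.mem_ideal.1 (a t).2)
    rw [map_mul, P.ι_e, ← mul_assoc, indep S (fun t => a t) hd t ht, zero_mul] at h
    exact h.symm
  have : a t = 0 := Subtype.ext (P.ι_injective (ha.trans (map_zero P.ι).symm))
  rw [this, map_zero]

/-- The crossed product maps onto `R` if `R` is generated by the partial representation. -/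
theorem crossedProductMap_surjective (hgen : Algebra.adjoin F (Set.range P.s) = ⊤) :
    Function.Surjective (P.crossedProductMap hξ hξ_one) := by
  have hs (x : G) : ∃ d, P.crossedProductMap hξ hξ_one d = P.s x := by
    have hn : x * (ξ x)⁻¹ ∈ N := by
      rw [← QuotientGroup.eq_one_iff, QuotientGroup.mk_mul, QuotientGroup.mk_inv, hξ,
        mul_inv_cancel]
    -- The factor e(ξ(x)) puts the coefficient into the ideal and disappears against s(ξ(x)).
    have he : P.u ⟨_, hn⟩ * P.e (ξ x) ∈ (P.twistedPartialAction hξ hξ_one).D x :=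
      P.mem_ideal.2 (by rw [mul_assoc, P.e_mul_self])
    refine ⟨(P.twistedPartialAction hξ hξ_one).delta x ⟨_, he⟩, ?_⟩
    rw [P.crossedProductMap_delta, map_mul, mul_assoc, P.e_mul_s, P.ι_u, P.s_mul_of_mem_left hn,
      inv_mul_cancel_right]
  intro y
  have hy : y ∈ Algebra.adjoin F (Set.range P.s) := hgen ▸ Algebra.mem_top
  induction hy using Algebra.adjoin_induction with
  | mem y h =>
    obtain ⟨x, rfl⟩ := h
    exact hs x
  | algebraMap c =>
    obtain ⟨d, hd⟩ := hs 1
    exact ⟨c • d, by rw [map_smul, hd, P.s_one, Algebra.algebraMap_eq_smul_one]⟩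
  | add y z _ _ hy hz =>
    obtain ⟨a, rfl⟩ := hy
    obtain ⟨b, rfl⟩ := hz
    exact ⟨a + b, map_add _ _ _⟩
  | mul y z _ _ hy hz =>
    obtain ⟨a, rfl⟩ := hy
    obtain ⟨b, rfl⟩ := hz
    exact ⟨a * b, P.crossedProductMap_mul hξ hξ_one a b⟩

end CovariantPair

/-! ### Averages over coset representatives. -/

/-- A sum over representatives is unchanged by a map that is injective on classes. -/
theorem sum_quotient_out_comp {α M : Type*} [AddCommMonoid M] (s : Setoid α)
    [Fintype (Quotient s)] (f : α → M) (hf : ∀ a b, s a b → f a = f b) (φ : α → α)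
    (hφ : ∀ a b, s (φ a) (φ b) → s a b) :
    ∑ k : Quotient s, f (φ k.out) = ∑ k : Quotient s, f k.out := by
  have hbij : Function.Bijective (fun k : Quotient s => Quotient.mk s (φ k.out)) := by
    refine Finite.injective_iff_bijective.1 fun a b hab => ?_
    rw [← Quotient.out_eq a, ← Quotient.out_eq b]
    exact Quotient.sound (hφ _ _ (Quotient.exact hab))
  refine Fintype.sum_bijective _ hbij _ _ fun k => hf _ _ ?_
  exact Quotient.exact (Quotient.out_eq (Quotient.mk s (φ k.out))).symm

section Average

variable (F : Type*) {G V : Type*} [Field F] [Group G] [AddCommGroup V] [Module F V]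
  {H N : Subgroup G} (hH : IsHeckePair H)

/-- The average of a function on `H` over representatives of the cosets of `H ∩ x⁻¹Hx`. -/
def average (H : Subgroup G) (x : G) (f : H → V) : V :=
  (Nat.card (InnerCosets H x) : F)⁻¹ • ∑ᶠ k : InnerCosets H x, f k.out

/-- `f` is constant on the cosets of `H ∩ x⁻¹Hx`. -/
def IsInvariant (x : G) (f : H → V) : Prop :=
  ∀ a b : H, x * (b * a⁻¹ : G) * x⁻¹ ∈ H → f a = f b

theorem innerCosets_rel_iff (x : G) (a b : H) :
    QuotientGroup.rightRel ((H ⊓ conjSubgroup H x).subgroupOf H) a b ↔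
      x * (b * a⁻¹ : G) * x⁻¹ ∈ H := by
  rw [QuotientGroup.rightRel_apply, Subgroup.mem_subgroupOf, Subgroup.mem_inf, conjSubgroup]
  simp only [Subgroup.mem_map, MulEquiv.coe_toMonoidHom, MulAut.conj_apply, inv_inv,
    Subgroup.coe_mul, Subgroup.coe_inv]
  constructor
  · rintro ⟨-, y, hy, h⟩
    rw [← h]
    simpa [mul_assoc] using hy
  · intro h
    exact ⟨H.mul_mem b.2 (H.inv_mem a.2), _, h, by simp [mul_assoc]⟩

variable {F}

theorem average_eq_sum (x : G) (f : H → V) [Fintype (InnerCosets H x)] :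
    average F H x f = (Nat.card (InnerCosets H x) : F)⁻¹ • ∑ k : InnerCosets H x, f k.out := by
  rw [average, finsum_eq_sum_of_fintype]

include hH

theorem map_average {W : Type*} [AddCommGroup W] [Module F W] (T : V →ₗ[F] W) (x : G)
    (f : H → V) : T (average F H x f) = average F H x fun h => T (f h) := by
  have := hH x
  have := Fintype.ofFinite (InnerCosets H x)
  rw [average_eq_sum, average_eq_sum, map_smul, map_sum]

/-- Change of variables: by `hφ` the map φ is injective on a finite set of cosets, hence permutes
it. -/
theorem average_comp (x : G) (f : H → V) (hf : IsInvariant x f) (φ : H → H)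
    (hφ : ∀ a b : H, x * (φ b * (φ a)⁻¹ : G) * x⁻¹ ∈ H → x * (b * a⁻¹ : G) * x⁻¹ ∈ H) :
    average F H x (fun h => f (φ h)) = average F H x f := by
  have := hH x
  have := Fintype.ofFinite (InnerCosets H x)
  rw [average_eq_sum, average_eq_sum]
  congr 1
  refine sum_quotient_out_comp (QuotientGroup.rightRel ((H ⊓ conjSubgroup H x).subgroupOf H)) f
    (fun a b h => hf a b ((innerCosets_rel_iff x a b).1 h)) φ fun a b h => ?_
  rw [innerCosets_rel_iff] at h ⊢
  exact hφ a b h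

theorem average_mul_right (x : G) (f : H → V) (hf : IsInvariant x f) (k : H) :
    average F H x (fun h => f (h * k)) = average F H x f :=
  average_comp hH x f hf _ fun a b h => by simpa [mul_assoc] using h

theorem average_const [CharZero F] (x : G) (v : V) : average F H x (fun _ : H => v) = v := by
  have := hH x
  have := Fintype.ofFinite (InnerCosets H x)
  rw [average_eq_sum, Finset.sum_const, Finset.card_univ, ← Nat.card_eq_fintype_card,
    ← Nat.cast_smul_eq_nsmul F, smul_smul, inv_mul_cancel₀, one_smul]
  have : Nonempty (InnerCosets H x) := ⟨Quotient.mk _ 1⟩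
  exact_mod_cast Nat.card_pos.ne'

theorem average_comm (x y : G) (f : H → H → V) :
    average F H x (fun h => average F H y (f h)) =
      average F H y (fun k => average F H x fun h => f h k) := by
  have := hH x
  have := hH y
  have := Fintype.ofFinite (InnerCosets H x)
  have := Fintype.ofFinite (InnerCosets H y)
  simp only [average_eq_sum, ← Finset.smul_sum]
  rw [Finset.sum_comm, smul_comm]

/-- Average f(hk) over both h and k. The h-average absorbs the right translation by k. The k-average
absorbs the left translation by h, because yhy⁻¹ lies in N and so normalizes H. Interchanging the
two averages compares them. -/
theorem average_congr_of_isInvariant [CharZero F] (hN : ∀ n ∈ N, ∀ h, n * h * n⁻¹ ∈ H ↔ h ∈ H)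
    (hHN : H ≤ N) [N.Normal] (x y : G) (f : H → V) (hx : IsInvariant x f)
    (hy : IsInvariant y f) : average F H x f = average F H y f := by
  calc average F H x f = average F H y (fun k => average F H x fun h => f (h * k)) := by
        simp only [average_mul_right hH x f hx, average_const hH]
    _ = average F H x (fun h => average F H y fun k => f (h * k)) := average_comm hH _ _ _
    _ = average F H x (fun _ : H => average F H y f) := by
        congr 1
        ext h
        refine average_comp hH y f hy (fun k => h * k) fun a b hab => ?_
        have hn : y * h * y⁻¹ ∈ N := Subgroup.Normal.conj_mem inferInstance _ (hHN h.2) y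
        rw [← hN _ hn]
        simpa [mul_assoc] using hab
    _ = average F H y f := average_const hH _ _

end Average

/-! ### The operators σ_x and the homomorphism from F[N/H]. -/

section Sigma

variable {F G : Type*} [Field F] [Group G] {H N : Subgroup G}

/-- The basis vector of the right coset `Hg`. -/
def cosetVec (F : Type*) [Field F] (H : Subgroup G) (g : G) : RightCosets H →₀ F :=
  Finsupp.single (rightCoset H g) 1

theorem cosetVec_eq {a b : G} (h : b * a⁻¹ ∈ H) : cosetVec F H a = cosetVec F H b := by
  rw [cosetVec, (rightCoset_eq_iff H a b).2 h, cosetVec]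

theorem linearMap_ext_cosetVec {V : Type*} [AddCommGroup V] [Module F V]
    {f g : (RightCosets H →₀ F) →ₗ[F] V} (h : ∀ t, f (cosetVec F H t) = g (cosetVec F H t)) :
    f = g := by
  refine Finsupp.lhom_ext' fun u => LinearMap.ext_ring ?_
  induction u using Quotient.inductionOn with
  | h t => exact h t

theorem sigma_cosetVec (hH : IsHeckePair H) (x t : G) :
    sigma F H x (cosetVec F H t) = average F H x fun h => cosetVec F H (x * h * t) := by
  obtain ⟨l, hl⟩ : ∃ l : H, (rightCoset H t).out = (l : G) * t := by
    have h : rightCoset H t = rightCoset H (rightCoset H t).out := (Quotient.out_eq _).symm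
    rw [rightCoset_eq_iff] at h
    exact ⟨⟨_, h⟩, by simp⟩
  rw [cosetVec, sigma, Finsupp.linearCombination_single, one_smul, hl]
  rw [← average_mul_right hH x (fun h => cosetVec F H (x * h * t)) _ l]
  · simp only [Subgroup.coe_mul, mul_assoc]
    rfl
  · intro a b h
    refine cosetVec_eq ?_
    simpa [mul_assoc] using h

variable [(H.subgroupOf N).Normal]

theorem conj_mem_iff (hHN : H ≤ N) {n : G} (hn : n ∈ N) (h : G) : n * h * n⁻¹ ∈ H ↔ h ∈ H := by
  have key : ∀ n ∈ N, ∀ h ∈ H, n * h * n⁻¹ ∈ H := fun n hn h hh => by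
    have := Subgroup.Normal.conj_mem (H := H.subgroupOf N) inferInstance ⟨h, hHN hh⟩ hh ⟨n, hn⟩
    exact this
  refine ⟨fun hh => ?_, key n hn h⟩
  have := key n⁻¹ (N.inv_mem hn) _ hh
  simpa [mul_assoc] using this

variable [CharZero F] (hHN : H ≤ N) (hH : IsHeckePair H)

include hHN hH

/-- As n normalizes H, all the cosets Hnht coincide with Hnt; characteristic zero permits dividing
by their number. -/
theorem sigma_cosetVec_of_mem {n : G} (hn : n ∈ N) (t : G) :
    sigma F H n (cosetVec F H t) = cosetVec F H (n * t) := by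
  rw [sigma_cosetVec hH]
  conv_rhs => rw [← average_const (F := F) hH n (cosetVec F H (n * t))]
  congr 1
  ext1 h
  refine (cosetVec_eq ?_).symm
  have := (conj_mem_iff hHN hn h).2 h.2
  simpa [mul_assoc] using this

theorem sigma_mul_of_mem {m n : G} (hm : m ∈ N) (hn : n ∈ N) :
    sigma F H (m * n) = sigma F H m * sigma F H n := by
  refine linearMap_ext_cosetVec fun t => ?_
  rw [Module.End.mul_apply, sigma_cosetVec_of_mem hHN hH hn, sigma_cosetVec_of_mem hHN hH hm,
    sigma_cosetVec_of_mem hHN hH (N.mul_mem hm hn), mul_assoc]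

theorem sigma_of_mem_subgroup {h : G} (hh : h ∈ H) : sigma F H h = 1 := by
  refine linearMap_ext_cosetVec fun t => ?_
  rw [sigma_cosetVec_of_mem hHN hH (hHN hh), Module.End.one_apply]
  refine (cosetVec_eq ?_).symm
  simpa using hh

/-- The homomorphism from `N` to the Hecke algebra. -/
def sigmaHom : N →* heckeAlgebra F H where
  toFun n := heckeSigma F H n
  map_one' := Subtype.ext (sigma_of_mem_subgroup hHN hH H.one_mem)
  map_mul' m n := Subtype.ext (sigma_mul_of_mem hHN hH m.2 n.2)

/-- The homomorphism from the group algebra of `N/H` to the Hecke algebra. -/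
def groupAlgebraHom : MonoidAlgebra F (N ⧸ H.subgroupOf N) →ₐ[F] heckeAlgebra F H :=
  MonoidAlgebra.lift F (heckeAlgebra F H) (N ⧸ H.subgroupOf N)
    (QuotientGroup.lift (H.subgroupOf N) (sigmaHom hHN hH) fun _ hn =>
      Subtype.ext (sigma_of_mem_subgroup hHN hH (Subgroup.mem_subgroupOf.1 hn)))

theorem groupAlgebraHom_of (n : N) :
    groupAlgebraHom hHN hH (MonoidAlgebra.of F _ (n : N ⧸ H.subgroupOf N)) =
      heckeSigma F H n := by
  rw [groupAlgebraHom, MonoidAlgebra.lift_of]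
  rfl

theorem groupAlgebraHom_of_cosetVec (n : N) (t : G) :
    (groupAlgebraHom hHN hH (MonoidAlgebra.of F _ (n : N ⧸ H.subgroupOf N))).1 (cosetVec F H t) =
      cosetVec F H (n * t) := by
  rw [groupAlgebraHom_of]
  exact sigma_cosetVec_of_mem hHN hH n.2 t

end Sigma

/-! ### Injectivity on F[N/H], the idempotents e_x and the product formula. -/

section GroupAlgebra

variable {F G : Type*} [Field F] [CharZero F] [Group G] {H N : Subgroup G}
  [(H.subgroupOf N).Normal] (hHN : H ≤ N) (hH : IsHeckePair H)

/-- The image operator, applied to the base coset, shows all coefficients; injectivity is immediate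
from this. -/
theorem groupAlgebraHom_apply_rightCoset (a : MonoidAlgebra F (N ⧸ H.subgroupOf N)) (n : N) :
    (groupAlgebraHom hHN hH a).1 (cosetVec F H 1) (rightCoset H n) = a.coeff n := by
  classical
  induction a using MonoidAlgebra.induction_on with
  | of m =>
    obtain ⟨m, rfl⟩ := QuotientGroup.mk_surjective m
    rw [groupAlgebraHom_of_cosetVec, mul_one, cosetVec, MonoidAlgebra.of_apply,
      MonoidAlgebra.coeff_single, Finsupp.single_apply, Finsupp.single_apply]
    refine if_congr ?_ rfl rfl
    rw [rightCoset_eq_iff, QuotientGroup.eq, Subgroup.mem_subgroupOf,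
      ← conj_mem_iff hHN (N.inv_mem m.2)]
    simp [mul_assoc]
  | add a b ha hb =>
    rw [map_add, MonoidAlgebra.coeff_add, Finsupp.add_apply, ← ha, ← hb]
    rfl
  | smul c a ha =>
    rw [map_smul, MonoidAlgebra.coeff_smul, Finsupp.smul_apply, ← ha]
    rfl

theorem groupAlgebraHom_injective :
    Function.Injective (groupAlgebraHom (F := F) hHN hH) := by
  intro a b hab
  ext q
  obtain ⟨n, rfl⟩ := QuotientGroup.mk_surjective q
  rw [← groupAlgebraHom_apply_rightCoset hHN hH, hab, groupAlgebraHom_apply_rightCoset]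

variable [N.Normal]

/-- The conjugate `x h x⁻¹` as an element of `N`. -/
def conjElement (x : G) (h : H) : N :=
  ⟨x * h * x⁻¹, Subgroup.Normal.conj_mem inferInstance _ (hHN h.2) x⟩

variable (F) in
/-- The average in the group algebra of `N/H` of the classes of the elements of `x H x⁻¹`. -/
def heckeIdempotent (x : G) : MonoidAlgebra F (N ⧸ H.subgroupOf N) :=
  average F H x fun h =>
    MonoidAlgebra.of F _ (conjElement hHN x h : N ⧸ H.subgroupOf N)

omit [CharZero F] in
theorem isInvariant_conjElement (x : G) :
    IsInvariant (H := H) x fun h =>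
      MonoidAlgebra.of F _ (conjElement hHN x h : N ⧸ H.subgroupOf N) := by
  intro a b hab
  have : (conjElement hHN x a : N ⧸ H.subgroupOf N) = conjElement hHN x b := by
    rw [QuotientGroup.eq, Subgroup.mem_subgroupOf, ← conj_mem_iff hHN (conjElement hHN x a).2]
    simpa [conjElement, mul_assoc] using hab
  simp only [this]

omit [CharZero F] in
include hH in
-- An average over the image of xHx⁻¹ absorbs each of its elements.
theorem heckeIdempotent_mul_of (x : G) (k : H) :
    heckeIdempotent F hHN x * MonoidAlgebra.of F _ (conjElement hHN x k : N ⧸ H.subgroupOf N) =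
      heckeIdempotent F hHN x := by
  have h₁ := map_average hH (LinearMap.mulRight F
    (MonoidAlgebra.of F _ (conjElement hHN x k : N ⧸ H.subgroupOf N))) x
    fun h => MonoidAlgebra.of F _ (conjElement hHN x h : N ⧸ H.subgroupOf N)
  have h₂ := average_mul_right (F := F) hH x _ (isInvariant_conjElement (F := F) hHN x) k
  refine h₁.trans (Eq.trans ?_ h₂)
  congr 1
  ext1 h
  rw [LinearMap.mulRight_apply, ← map_mul, ← QuotientGroup.mk_mul]
  congr 2
  exact Subtype.ext (by simp [conjElement, mul_assoc])

omit [CharZero F] in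
include hH in
theorem of_mul_heckeIdempotent (x : G) (n : N) :
    MonoidAlgebra.of F _ (n : N ⧸ H.subgroupOf N) * heckeIdempotent F hHN x =
      heckeIdempotent F hHN x * MonoidAlgebra.of F _ (n : N ⧸ H.subgroupOf N) := by
  have hn : x⁻¹ * n * x ∈ N := by
    have := Subgroup.Normal.conj_mem (H := N) inferInstance _ n.2 x⁻¹
    rwa [inv_inv] at this
  -- Conjugation by n on xHx⁻¹ is conjugation by x⁻¹nx on H; it permutes the cosets being averaged.
  let φ : H → H := fun h => ⟨x⁻¹ * n * x * h * (x⁻¹ * n * x)⁻¹, (conj_mem_iff hHN hn _).2 h.2⟩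
  have h₁ := map_average hH (LinearMap.mulLeft F (MonoidAlgebra.of F _ (n : N ⧸ H.subgroupOf N))) x
    fun h => MonoidAlgebra.of F _ (conjElement hHN x h : N ⧸ H.subgroupOf N)
  have h₂ := map_average hH (LinearMap.mulRight F (MonoidAlgebra.of F _ (n : N ⧸ H.subgroupOf N)))
    x fun h => MonoidAlgebra.of F _ (conjElement hHN x (φ h) : N ⧸ H.subgroupOf N)
  have h₃ := average_comp (F := F) hH x _ (isInvariant_conjElement (F := F) hHN x) φ
    fun a b hab => by
      rw [← conj_mem_iff hHN n.2]
      simpa [φ, mul_assoc] using hab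
  rw [h₃] at h₂
  refine h₁.trans (Eq.trans ?_ h₂.symm)
  congr 1
  ext1 h
  rw [LinearMap.mulLeft_apply, LinearMap.mulRight_apply, ← map_mul, ← map_mul,
    ← QuotientGroup.mk_mul, ← QuotientGroup.mk_mul]
  congr 2
  exact Subtype.ext (by simp [conjElement, φ, mul_assoc])

omit [CharZero F] in
include hH in
theorem heckeIdempotent_comm (x : G) (a : MonoidAlgebra F (N ⧸ H.subgroupOf N)) :
    heckeIdempotent F hHN x * a = a * heckeIdempotent F hHN x := by
  induction a using MonoidAlgebra.induction_on with
  | of m =>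
    obtain ⟨m, rfl⟩ := QuotientGroup.mk_surjective m
    exact (of_mul_heckeIdempotent hHN hH x m).symm
  | add a b ha hb => rw [mul_add, add_mul, ha, hb]
  | smul c a ha => rw [mul_smul_comm, smul_mul_assoc, ha]

/-- The action of the group algebra on a vector. -/
def groupAlgebraApply (v : RightCosets H →₀ F) :
    MonoidAlgebra F (N ⧸ H.subgroupOf N) →ₗ[F] (RightCosets H →₀ F) :=
  (LinearMap.applyₗ v) ∘ₗ (heckeAlgebra F H).val.toLinearMap ∘ₗ
    (groupAlgebraHom hHN hH).toLinearMap

theorem groupAlgebraHom_heckeIdempotent (x g : G) :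
    (groupAlgebraHom hHN hH (heckeIdempotent F hHN x)).1 (cosetVec F H g) =
      average F H x fun h => cosetVec F H (x * h * x⁻¹ * g) := by
  refine (map_average hH (groupAlgebraApply hHN hH (cosetVec F H g)) x _).trans ?_
  congr 1
  ext1 h
  exact groupAlgebraHom_of_cosetVec hHN hH _ _

/-- Since σ_x δ_{Hyht} = e_x δ_{Hxyht}, the two sides average the same function of h, once over the
cosets for y and once over those for xy. `average_congr_of_isInvariant` identifies the averages. -/
theorem sigma_mul_sigma (x y : G) :
    sigma F H x * sigma F H y =
      (groupAlgebraHom hHN hH (heckeIdempotent F hHN x)).1 * sigma F H (x * y) := by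
  refine linearMap_ext_cosetVec fun t => ?_
  rw [Module.End.mul_apply, Module.End.mul_apply, sigma_cosetVec hH, sigma_cosetVec hH,
    map_average hH, map_average hH]
  have hxy (h : H) : sigma F H x (cosetVec F H (y * h * t)) =
      (groupAlgebraHom hHN hH (heckeIdempotent F hHN x)).1 (cosetVec F H (x * y * h * t)) := by
    rw [sigma_cosetVec hH, groupAlgebraHom_heckeIdempotent]
    simp only [mul_assoc, inv_mul_cancel_left]
  simp only [hxy]
  refine average_congr_of_isInvariant hH (fun n hn h => conj_mem_iff hHN hn h) hHN y (x * y) _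
    ?_ ?_
  -- If k = yba⁻¹y⁻¹ lies in H, then xybt = (xkx⁻¹)(xyat), and e_x absorbs xkx⁻¹.
  · intro a b hab
    have h₁ := groupAlgebraHom_of_cosetVec (F := F) hHN hH (conjElement hHN x ⟨_, hab⟩)
      (x * y * a * t)
    have h₂ := heckeIdempotent_mul_of (F := F) hHN hH x ⟨_, hab⟩
    have h₃ : (conjElement hHN x ⟨_, hab⟩ : G) * (x * y * a * t) = x * y * b * t := by
      simp [conjElement, mul_assoc]
    rw [h₃] at h₁
    simp only
    rw [← h₁]
    conv_lhs => rw [← h₂, map_mul]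
    rfl
  · intro a b hab
    have : cosetVec F H (x * y * a * t) = cosetVec F H (x * y * b * t) := by
      refine cosetVec_eq ?_
      simpa [mul_assoc] using hab
    simp only [this]

omit [CharZero F] in
theorem span_range_of_eq_top {Q : Type*} [Monoid Q] :
    Submodule.span F (Set.range (MonoidAlgebra.of F Q)) = ⊤ := by
  refine Submodule.eq_top_iff'.2 fun a => ?_
  induction a using MonoidAlgebra.induction_on with
  | of m => exact Submodule.subset_span ⟨m, rfl⟩
  | add a b ha hb => exact Submodule.add_mem _ ha hb
  | smul c a ha => exact Submodule.smul_mem _ c ha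

variable (F) in
/-- The Hecke algebra with its elements `σ_x` and its subalgebra `F[N/H]`. -/
def heckeCovariantPair :
    CovariantPair F (MonoidAlgebra F (N ⧸ H.subgroupOf N)) (heckeAlgebra F H) N where
  ι := groupAlgebraHom hHN hH
  ι_injective := groupAlgebraHom_injective hHN hH
  s := heckeSigma F H
  u := (MonoidAlgebra.of F (N ⧸ H.subgroupOf N)).comp (QuotientGroup.mk' (H.subgroupOf N))
  e := heckeIdempotent F hHN
  ι_u := groupAlgebraHom_of hHN hH
  e_comm := heckeIdempotent_comm hHN hH
  s_mul x y := Subtype.ext (sigma_mul_sigma hHN hH x y)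
  span_u := by
    rw [MonoidHom.coe_comp, Set.range_comp, QuotientGroup.coe_mk',
      QuotientGroup.mk_surjective.range_eq, Set.image_univ, span_range_of_eq_top]

end GroupAlgebra

/-! ### The grading by G/N and independence of the summands. -/

section Grading

variable {F G : Type*} [Field F] [CharZero F] [Group G] {H N : Subgroup G}

/-- The right cosets of `H` contained in a given coset of `N`. -/
def cosetsOver (H N : Subgroup G) (t : G ⧸ N) : Set (RightCosets H) :=
  {c | ∃ k : G, rightCoset H k = c ∧ (k : G ⧸ N) = t}

variable [N.Normal] (hHN : H ≤ N) (hH : IsHeckePair H)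

include hHN in
theorem eq_of_mem_cosetsOver {c : RightCosets H} {s t : G ⧸ N} (hs : c ∈ cosetsOver H N s)
    (ht : c ∈ cosetsOver H N t) : s = t := by
  obtain ⟨k, rfl, rfl⟩ := hs
  obtain ⟨l, hl, rfl⟩ := ht
  rw [rightCoset_eq_iff] at hl
  have h := hHN hl
  rwa [← QuotientGroup.eq_one_iff, QuotientGroup.mk_mul, QuotientGroup.mk_inv,
    mul_inv_eq_one] at h

omit [CharZero F] [N.Normal] in
theorem cosetVec_mem_supported {k : G} {t : G ⧸ N} (h : (k : G ⧸ N) = t) :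
    cosetVec F H k ∈ Finsupp.supported F F (cosetsOver H N t) :=
  Finsupp.single_mem_supported F 1 ⟨k, rfl, h⟩

omit [CharZero F] [N.Normal] in
include hH in
theorem average_mem {V : Type*} [AddCommGroup V] [Module F V] (W : Submodule F V) (x : G)
    {f : H → V} (hf : ∀ h, f h ∈ W) : average F H x f ∈ W := by
  have := hH x
  have := Fintype.ofFinite (InnerCosets H x)
  rw [average_eq_sum]
  exact W.smul_mem _ (W.sum_mem fun k _ => hf _)

variable [(H.subgroupOf N).Normal]

theorem groupAlgebraHom_mem_supported (a : MonoidAlgebra F (N ⧸ H.subgroupOf N)) (k : G) :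
    (groupAlgebraHom hHN hH a).1 (cosetVec F H k) ∈
      Finsupp.supported F F (cosetsOver H N (k : G ⧸ N)) := by
  induction a using MonoidAlgebra.induction_on with
  | of m =>
    obtain ⟨m, rfl⟩ := QuotientGroup.mk_surjective m
    rw [groupAlgebraHom_of_cosetVec]
    refine cosetVec_mem_supported ?_
    rw [QuotientGroup.mk_mul, (QuotientGroup.eq_one_iff (m : G)).2 m.2, one_mul]
  | add a b ha hb =>
    rw [map_add]
    exact Submodule.add_mem _ ha hb
  | smul c a ha =>
    rw [map_smul]
    exact Submodule.smul_mem _ c ha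

theorem groupAlgebraHom_mul_sigma_mem_supported (a : MonoidAlgebra F (N ⧸ H.subgroupOf N))
    (x g : G) :
    ((groupAlgebraHom hHN hH a).1 * sigma F H x) (cosetVec F H g) ∈
      Finsupp.supported F F (cosetsOver H N (x * g : G ⧸ N)) := by
  rw [Module.End.mul_apply, sigma_cosetVec hH, map_average hH]
  refine average_mem hH _ x fun h => ?_
  have := groupAlgebraHom_mem_supported (F := F) hHN hH a (x * h * g)
  rwa [QuotientGroup.mk_mul, QuotientGroup.mk_mul,
    (QuotientGroup.eq_one_iff (h : G)).2 (hHN h.2), mul_one] at this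

theorem hecke_independent {ξ : G ⧸ N → G} (hξ : ∀ t : G ⧸ N, (ξ t : G ⧸ N) = t)
    (S : Finset (G ⧸ N)) (a : G ⧸ N → MonoidAlgebra F (N ⧸ H.subgroupOf N))
    (h : ∑ t ∈ S, groupAlgebraHom hHN hH (a t) * heckeSigma F H (ξ t) = 0) (t : G ⧸ N)
    (ht : t ∈ S) : groupAlgebraHom hHN hH (a t) * heckeSigma F H (ξ t) = 0 := by
  refine Subtype.ext (linearMap_ext_cosetVec fun g => Finsupp.ext fun c => ?_)
  have hmem (s : G ⧸ N) := groupAlgebraHom_mul_sigma_mem_supported hHN hH (a s) (ξ s) g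
  simp only [hξ, Finsupp.mem_supported'] at hmem
  -- For c over the coset t·gN, only the term of t can be nonzero at c, by cancelling gN in G/N. For
  -- any other c the term of t itself vanishes.
  by_cases hc : c ∈ cosetsOver H N (t * g : G ⧸ N)
  · have h₁ : ∑ s ∈ S, ((groupAlgebraHom hHN hH (a s)).1 * sigma F H (ξ s))
        (cosetVec F H g) c = 0 := by
      have h₂ := congrArg (fun T : heckeAlgebra F H => T.1 (cosetVec F H g) c) h
      simpa [heckeSigma, Finsupp.finsetSum_apply] using h₂
    rwa [Finset.sum_eq_single_of_mem t ht] at h₁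
    intro s _ hs
    exact hmem s c fun hc' => hs (mul_right_cancel (eq_of_mem_cosetsOver hHN hc' hc))
  · exact hmem t c hc

end Grading

theorem adjoin_range_heckeSigma (F : Type*) {G : Type*} [Field F] [Group G] (H : Subgroup G) :
    Algebra.adjoin F (Set.range (heckeSigma F H)) = ⊤ := by
  have h : Set.range (heckeSigma F H) =
      ((↑) : heckeAlgebra F H → _) ⁻¹' Set.range (sigma F H) := by
    ext y
    exact exists_congr fun x => Subtype.ext_iff
  rw [h]
  exact Algebra.adjoin_adjoin_coe_preimage

end HeckeCrossed

end

/-! ### Assembly of the theorem. -/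

open HeckeCrossed in
theorem theorem11p9 {F G : Type*} [Field F] [CharZero F] [Group G] (H N : Subgroup G)
    (hHN : H ≤ N) [(H.subgroupOf N).Normal] [N.Normal] (hH : IsHeckePair H)
    (ξ : G ⧸ N → G) (hξ : ∀ t : G ⧸ N, (ξ t : G ⧸ N) = t) (hξ_one : ξ 1 = 1) :
    -- the embedding of the group algebra `F[N/H]` in the Hecke algebra
    ∃ ι : MonoidAlgebra F (N ⧸ H.subgroupOf N) →ₐ[F] heckeAlgebra F H,
      Function.Injective ι ∧
      (∀ n : N, ι (MonoidAlgebra.of F (N ⧸ H.subgroupOf N) (n : N ⧸ H.subgroupOf N)) =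
        heckeSigma F H (n : G)) ∧
      ∃ Θ : TwistedPartialAction F (G ⧸ N) (MonoidAlgebra F (N ⧸ H.subgroupOf N)),
        -- the ideals
        (∀ x : G, ∃ e : MonoidAlgebra F (N ⧸ H.subgroupOf N),
          ι e = heckeSigma F H x * heckeSigma F H x⁻¹ ∧
          IsIdempotentElem e ∧ (∀ a, e * a = a * e) ∧
          Θ.D (x : G ⧸ N) = Ideal.span {e}) ∧
        -- the isomorphisms
        (∀ (t : G ⧸ N) (a : Θ.D t⁻¹),
          ι (Θ.θ t a) = heckeSigma F H (ξ t) * ι a * heckeSigma F H (ξ t)⁻¹) ∧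
        -- the cocycle
        (∀ r s : G ⧸ N, ∃ u : MonoidAlgebra F (N ⧸ H.subgroupOf N),
          ι u = heckeSigma F H (ξ r * ξ s * (ξ (r * s))⁻¹) ∧
          ∀ a : ↥(Θ.D r ⊓ Θ.D (r * s)),
            ((Θ.w r s).val.L a : MonoidAlgebra F (N ⧸ H.subgroupOf N)) = u * a ∧
            ((Θ.w r s).val.R a : MonoidAlgebra F (N ⧸ H.subgroupOf N)) = a * u) ∧
        -- the crossed product is isomorphic to the Hecke algebra
        ∃ Φ : Θ.CrossedProduct ≃ₗ[F] heckeAlgebra F H, ∀ a b, Φ (a * b) = Φ a * Φ b := by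
  let P := heckeCovariantPair F hHN hH
  refine ⟨P.ι, P.ι_injective, groupAlgebraHom_of hHN hH, P.twistedPartialAction hξ hξ_one,
    fun x => ⟨P.e x, P.ι_e x, P.e_mul_self x, P.e_comm x, ?_⟩, fun t a => P.ι_conj _ _,
    fun r s => ⟨P.u (CovariantPair.sectionCocycle hξ r s), P.ι_u _, fun a => ⟨rfl, rfl⟩⟩,
    LinearEquiv.ofBijective (P.crossedProductMap hξ hξ_one)
      ⟨P.crossedProductMap_injective hξ hξ_one (hecke_independent hHN hH hξ),
        P.crossedProductMap_surjective hξ hξ_one (adjoin_range_heckeSigma F H)⟩,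
    P.crossedProductMap_mul hξ hξ_one⟩
  change Ideal.span {P.e (ξ x)} = _
  rw [P.e_eq_of_mk_eq (hξ x)]
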